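/- **Theorem 2.1.** Let $A \in \mathbb{C}^{m\times n}$ ($m \ge n$) be a full-rank matrix with polar decomposition $A = UH$, where $U \in \mathbb{C}^{m\times n}$ has orthonormal columns and $H \in \mathbb{C}^{n\times n}$ is Hermitian positive definite, and let $\mathcal{P}$ be the map sending a full-rank $m\times n$ matrix to the factor $U$ of its polar decomposition. Let $E \in \mathbb{C}^{m\times n}$, and set $\Omega = \frac12\left(U^*E - (U^*E)^*\right)$ and $S = \frac12\left(U^*E + (U^*E)^*\right)$. Let $D \subseteq \mathbb{C}$ be open and let $h$ be the primary matrix function of a scalar function that is smooth (that is, holomorphic) on $D$; thus $h(Z) = p(Z)$, where $p$ is any polynomial that interpolates the scalar function on the spectrum $\Lambda(Z)$ in the sense of Hermite, an eigenvalue $\lambda$ carrying the conditions on the derivatives of orders $0,\dots,n_\lambda-1$, where $n_\lambda$ is the size of the largest Jordan block of $Z$ for $\lambda$. Suppose that $h(Z^*) = h(Z)^*$ for every square matrix $Z$ with $\Lambda(Z), \Lambda(Z^*) \subseteq D$. Suppose that for each of the two initial conditions $$Z_0 = \begin{pmatrix} H & \Omega \\ 0 & -H \end{pmatrix} \qquad\text{and}\qquad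 Z_0 = \begin{pmatrix} H & S \\ 0 & H \end{pmatrix}$$ the iteration $Z_{k+1} = Z_k h(Z_k^2)$ satisfies $\Lambda(Z_k^2) \subseteq D$ for all $k \ge 0$ and $Z_k \to \mathrm{sign}(Z_0)$ as $k \to \infty$, where $\mathrm{sign}(Z) = Z (Z^2)^{-1/2}$ (principal branch). Let $g(X) = X h(X^*X)$ for $X \in \mathbb{C}^{m\times n}$, and write $L_F(X,\cdot)$ for the ($\mathbb{R}$-linear) Fréchet derivative of a map $F$ at $X$. Then the iteration $$X_{k+1} = g(X_k),\quad X_0 = A, \qquad\qquad E_{k+1} = L_g(X_k, E_k),\quad E_0 = E,$$ is well defined ($\Lambda(X_k^*X_k) \subseteq D$ and $g$ is Fréchet differentiable at $X_k$ for every $k$), $\mathcal{P}$ is Fréchet differentiable at $A$ with $\mathcal{P}(A) = U$, and $$X_k \to \mathcal{P}(A) = U, \qquad E_k \to L_{\mathcal{P}}(A,E) \qquad (k \to \infty).$$ -/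

import Mathlib

open Matrix Polynomial Filter Topology
open scoped ComplexOrder ContDiff

/-- `p` interpolates the scalar function `f` on the spectrum of `A` in the sense of Hermite:
for every eigenvalue `z` of `A`, the derivatives of `p` and `f` at `z` agree up to (and excluding)
the order given by the multiplicity of `z` in the minimal polynomial of `A`, that is, the size of
the largest Jordan block of `A` for `z`.  (If `z` is not an eigenvalue this multiplicity is `0`
and nothing is required.) -/
def InterpolatesOnSpectrum {ι : Type*} [Fintype ι] [DecidableEq ι]
    (f : ℂ → ℂ) (A : Matrix ι ι ℂ) (p : ℂ[X]) : Prop :=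
  ∀ z : ℂ, ∀ j < (minpoly ℂ A).rootMultiplicity z,
    (derivative^[j] p).eval z = iteratedDeriv j f z

theorem exists_jet (a : ℂ) (k : ℕ) (c : ℕ → ℂ) :
    ∃ q : ℂ[X], ∀ j < k, (derivative^[j] q).eval a = c j := by
  refine ⟨taylor (-a) (∑ i ∈ Finset.range k, monomial i (c i / (i.factorial : ℂ))), ?_⟩
  intro j hj
  have h1 : taylor a (taylor (-a) (∑ i ∈ Finset.range k, monomial i (c i / (i.factorial : ℂ))))
      = ∑ i ∈ Finset.range k, monomial i (c i / (i.factorial : ℂ)) := by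
    rw [taylor_taylor]; simp
  have h2 := taylor_coeff (r := a)
    (f := taylor (-a) (∑ i ∈ Finset.range k, monomial i (c i / (i.factorial : ℂ)))) j
  rw [h1] at h2
  rw [← factorial_smul_hasseDeriv]
  have h3 : (j.factorial : ℂ) ≠ 0 := by exact_mod_cast j.factorial_ne_zero
  rw [LinearMap.smul_apply, nsmul_eq_mul, eval_mul, ← h2]
  simp only [finsetSum_coeff, coeff_monomial, Finset.sum_ite_eq', Finset.mem_range, hj, if_true,
    eval_natCast]
  field_simp

theorem eval_iterate_derivative_eq_of_dvd {a : ℂ} {k : ℕ} {p q : ℂ[X]}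
    (h : (X - C a) ^ k ∣ p - q) {j : ℕ} (hj : j < k) :
    (derivative^[j] p).eval a = (derivative^[j] q).eval a := by
  have h1 := pow_sub_dvd_iterate_derivative_of_pow_dvd j h
  rw [iterate_derivative_sub] at h1
  have h2 : (X - C a) ∣ derivative^[j] p - derivative^[j] q :=
    (dvd_pow_self _ (Nat.sub_ne_zero_of_lt hj)).trans h1
  have h3 := dvd_iff_isRoot.mp h2
  simpa [IsRoot, sub_eq_zero] using h3

/-- An interpolating polynomial exists. -/
theorem exists_interpolatesOnSpectrum {ι : Type*} [Fintype ι] [DecidableEq ι]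
    (f : ℂ → ℂ) (A : Matrix ι ι ℂ) : ∃ p : ℂ[X], InterpolatesOnSpectrum f A p := by
  classical
  choose q hq using fun z : ℂ =>
    exists_jet z ((minpoly ℂ A).rootMultiplicity z) (fun j => iteratedDeriv j f z)
  have h0 : minpoly ℂ A ≠ 0 := minpoly.ne_zero (Matrix.isIntegral A)
  obtain ⟨p, hp⟩ := Ideal.exists_forall_sub_mem_ideal
    (I := fun z : (minpoly ℂ A).roots.toFinset =>
      Ideal.span {(X - C z.1) ^ (minpoly ℂ A).rootMultiplicity z.1})
    (by
      intro i j hij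
      rw [Function.onFun, Ideal.isCoprime_span_singleton_iff]
      exact (isCoprime_X_sub_C_of_isUnit_sub
        (sub_ne_zero.mpr (Subtype.coe_injective.ne hij)).isUnit).pow)
    (fun z => q z.1)
  refine ⟨p, fun z j hj => ?_⟩
  have hz : z ∈ (minpoly ℂ A).roots.toFinset := by
    rw [Multiset.mem_toFinset, ← Multiset.count_pos, count_roots]
    omega
  have := hp ⟨z, hz⟩
  rw [Ideal.mem_span_singleton] at this
  rw [eval_iterate_derivative_eq_of_dvd this hj, hq z j hj]

/-- All interpolating polynomials take the same value at `A`. -/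
theorem InterpolatesOnSpectrum.aeval_eq {ι : Type*} [Fintype ι] [DecidableEq ι]
    {f : ℂ → ℂ} {A : Matrix ι ι ℂ} {p q : ℂ[X]}
    (hp : InterpolatesOnSpectrum f A p) (hq : InterpolatesOnSpectrum f A q) :
    aeval A p = aeval A q := by
  classical
  by_cases hpq : p - q = 0
  · rw [sub_eq_zero.mp hpq]
  have h0 : minpoly ℂ A ≠ 0 := minpoly.ne_zero (Matrix.isIntegral A)
  have hdvd : minpoly ℂ A ∣ p - q := by
    rw [IsAlgClosed.dvd_iff_roots_le_roots h0 hpq, Multiset.le_iff_count]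
    intro z
    rw [count_roots, count_roots]
    by_contra! hlt
    refine lt_irrefl ((p - q).rootMultiplicity z)
      ((lt_rootMultiplicity_iff_isRoot_iterate_derivative hpq).mpr ?_)
    intro m hm
    rw [IsRoot, iterate_derivative_sub, eval_sub, hp z m (by omega), hq z m (by omega), sub_self]
  obtain ⟨r, hr⟩ := hdvd
  have : aeval A (p - q) = 0 := by rw [hr, map_mul, minpoly.aeval, zero_mul]
  rwa [map_sub, sub_eq_zero] at this

/-- The primary matrix function attached to a scalar function `f` (Hermite interpolation
definition): `f(A) = p(A)` for any polynomial `p` interpolating `f` on the spectrum of `A`.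
It is meaningful when `f` is holomorphic near the spectrum of `A`. -/
noncomputable def primaryMatrixFunction {ι : Type*} [Fintype ι] [DecidableEq ι]
    (f : ℂ → ℂ) (A : Matrix ι ι ℂ) : Matrix ι ι ℂ :=
  aeval A (exists_interpolatesOnSpectrum f A).choose

/-- The value does not depend on the choice of the interpolating polynomial. -/
theorem primaryMatrixFunction_eq_aeval {ι : Type*} [Fintype ι] [DecidableEq ι]
    {f : ℂ → ℂ} {A : Matrix ι ι ℂ} {p : ℂ[X]} (hp : InterpolatesOnSpectrum f A p) :
    primaryMatrixFunction f A = aeval A p :=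
  (exists_interpolatesOnSpectrum f A).choose_spec.aeval_eq hp

/-- The matrix sign function `sign(Z) = Z (Z²)^{-1/2}`, with the principal branch of `w ^ (-1/2)`
(for `Z` without purely imaginary eigenvalues, the spectrum of `Z²` avoids the closed negative real
axis). -/
noncomputable def matrixSign {ι : Type*} [Fintype ι] [DecidableEq ι]
    (Z : Matrix ι ι ℂ) : Matrix ι ι ℂ :=
  Z * primaryMatrixFunction (fun w : ℂ => w ^ (-(1 / 2) : ℂ)) (Z ^ 2)

/-- The skew-Hermitian part of a square matrix. -/
noncomputable def skewPart {n : ℕ} (B : Matrix (Fin n) (Fin n) ℂ) : Matrix (Fin n) (Fin n) ℂ :=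
  (1 / 2 : ℂ) • (B - Bᴴ)

/-- The Hermitian part of a square matrix. -/
noncomputable def symPart {n : ℕ} (B : Matrix (Fin n) (Fin n) ℂ) : Matrix (Fin n) (Fin n) ℂ :=
  (1 / 2 : ℂ) • (B + Bᴴ)

/-- `A = U H` is a polar decomposition: `U` has orthonormal columns and `H` is Hermitian positive
definite. -/
def IsPolarDecomposition {m n : ℕ} (A U : Matrix (Fin m) (Fin n) ℂ)
    (H : Matrix (Fin n) (Fin n) ℂ) : Prop :=
  Uᴴ * U = 1 ∧ H.PosDef ∧ A = U * H

open Classical in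
/-- The map `𝒫` sending a full-rank matrix `A` (with at least as many rows as columns) to the
factor `U` of its polar decomposition `A = U H`; it is `0` if there is no such decomposition. -/
noncomputable def polarFactor {m n : ℕ} (A : Matrix (Fin m) (Fin n) ℂ) :
    Matrix (Fin m) (Fin n) ℂ :=
  if h : ∃ U : Matrix (Fin m) (Fin n) ℂ, ∃ H : Matrix (Fin n) (Fin n) ℂ,
      IsPolarDecomposition A U H then h.choose else 0

/-- The map `g(X) = X h(X* X)`, where `h` is the primary matrix function attached to `f`. -/
noncomputable def polarStep {m n : ℕ} (f : ℂ → ℂ) (X : Matrix (Fin m) (Fin n) ℂ) :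
    Matrix (Fin m) (Fin n) ℂ :=
  X * primaryMatrixFunction f (Xᴴ * X)

/-- The Fréchet derivative `L_F(X, E)` of a map `F` between spaces of complex matrices, at `X` in
the direction `E`.  The spaces are regarded as real vector spaces, because maps such as the polar
factor involve the conjugate transpose and are not complex differentiable. -/
noncomputable def frechetDeriv {m n p q : ℕ}
    (F : Matrix (Fin m) (Fin n) ℂ → Matrix (Fin p) (Fin q) ℂ)
    (X E : Matrix (Fin m) (Fin n) ℂ) : Matrix (Fin p) (Fin q) ℂ :=
  fderiv ℝ F X E

/-! Put `K = (E - U U* E) H⁻¹`, so that `U* K = 0` and `E = U(Ω + S) + K H`. The invariant is that,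
for Hermitian `H_k`, `S_k` and skew-Hermitian `Ω_k`, the two sign iterates are block triangular with
upper rows `(H_k, Ω_k)` and `(H_k, S_k)`, while `X_k = U H_k` and `E_k = U(Ω_k + S_k) + K H_k`.

It persists because the squares of the block matrices have diagonal `H_k²` and corners `H_k Ω_k -
Ω_k H_k` and `H_k S_k + S_k H_k`, whose sum is the derivative of `X* X` at `X_k` along `E_k`. The
corner of `h` at such a block matrix is the derivative of `h` at `H_k²` along the corner, hence
additive (`exists_blocks_step`). The symmetries survive by `isHermitian_blocks_of_star`.

The limit needs no separate computation: near `A` the polar factor is the step with `w ^ (-1/2)` in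
place of `h`, and `sign` is the same step on block matrices. The one-step lemma thus identifies
`L_𝒫(A, E)` with the combined corners of the two signs, plus `K`. -/

/-! ### Derivatives of matrix products and polynomials. -/

section Calculus

open scoped Matrix.Norms.L2Operator

variable {V : Type*} [NormedAddCommGroup V] [NormedSpace ℝ V]

/-- Product rule for (rectangular) matrix multiplication. -/
theorem HasFDerivAt.exists_matrix_mul {l m n : Type*} [Fintype l] [Fintype m] [Fintype n]
    [DecidableEq l] [DecidableEq m] [DecidableEq n]
    {a : V → Matrix l m ℂ} {b : V → Matrix m n ℂ} {a' : V →L[ℝ] Matrix l m ℂ}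
    {b' : V →L[ℝ] Matrix m n ℂ} {x : V} (ha : HasFDerivAt a a' x) (hb : HasFDerivAt b b' x) :
    ∃ c' : V →L[ℝ] Matrix l n ℂ, HasFDerivAt (fun y => a y * b y) c' x ∧
      ∀ e, c' e = a x * b' e + a' e * b x :=
  ⟨_, ContinuousLinearMap.hasFDerivAt_of_bilinear
    (LinearMap.toContinuousBilinearMap (LinearMap.mk₂ ℝ
      (fun (M : Matrix l m ℂ) (N : Matrix m n ℂ) => M * N) Matrix.add_mul
      (fun c M N => Matrix.smul_mul c M N) Matrix.mul_add
      (fun c M N => Matrix.mul_smul M c N))) ha hb, fun _ => rfl⟩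

/-- The derivative of a polynomial matrix function is the upper right block of its value at a
block upper triangular matrix. -/
theorem HasFDerivAt.exists_aeval {ι : Type*} [Fintype ι] [DecidableEq ι] {G : V → Matrix ι ι ℂ}
    {G' : V →L[ℝ] Matrix ι ι ℂ} {x : V} (hG : HasFDerivAt G G' x) (p : ℂ[X]) :
    ∃ D : V →L[ℝ] Matrix ι ι ℂ, HasFDerivAt (fun y => aeval (G y) p) D x ∧
      ∀ e, aeval (fromBlocks (G x) (G' e) 0 (G x)) p
        = fromBlocks (aeval (G x) p) (D e) 0 (aeval (G x) p) := by
  induction p using Polynomial.induction_on with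
  | C a =>
    refine ⟨0, by simpa using hasFDerivAt_const _ x, fun e => ?_⟩
    simp only [aeval_C, Algebra.algebraMap_eq_smul_one, ← fromBlocks_one, fromBlocks_smul,
      smul_zero]
    rfl
  | add p q hp hq =>
    obtain ⟨D₁, h₁, e₁⟩ := hp
    obtain ⟨D₂, h₂, e₂⟩ := hq
    refine ⟨D₁ + D₂, (h₁.add h₂).congr_of_eventuallyEq (.of_forall fun y => by simp), fun e => ?_⟩
    simp [e₁, e₂, fromBlocks_add]
  | monomial n a h =>
    obtain ⟨D, hD, eD⟩ := h
    obtain ⟨D', hD', eD'⟩ := hD.exists_matrix_mul hG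
    refine ⟨D', ?_, fun e => ?_⟩
    · simpa [pow_succ, mul_assoc] using hD'
    · rw [pow_succ, ← mul_assoc]
      generalize C a * X ^ n = q at eD eD' ⊢
      rw [map_mul, map_mul, eD, aeval_X, aeval_X, fromBlocks_multiply, eD']
      simp only [zero_mul, mul_zero, add_zero, zero_add]

/-- Linearity in `K` is the point: it lets the skew and Hermitian corners be treated separately and
then added. -/
theorem exists_linearMap_aeval_fromBlocks {ι : Type*} [Fintype ι] [DecidableEq ι]
    (B : Matrix ι ι ℂ) (p : ℂ[X]) :
    ∃ D : Matrix ι ι ℂ →L[ℝ] Matrix ι ι ℂ, ∀ K,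
      aeval (fromBlocks B K 0 B) p = fromBlocks (aeval B p) (D K) 0 (aeval B p) := by
  obtain ⟨D, -, h⟩ := (hasFDerivAt_id (𝕜 := ℝ) B).exists_aeval p
  exact ⟨D, h⟩

theorem hasFDerivAt_conjTranspose {m n : Type*} [Fintype m] [Fintype n] [DecidableEq m]
    [DecidableEq n] (x : Matrix m n ℂ) :
    ∃ D : Matrix m n ℂ →L[ℝ] Matrix n m ℂ, HasFDerivAt (fun y : Matrix m n ℂ => yᴴ) D x ∧
      ∀ e, D e = eᴴ := by
  let T : Matrix m n ℂ →ₗ[ℝ] Matrix n m ℂ :=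
    { toFun := fun y => yᴴ
      map_add' := conjTranspose_add
      map_smul' := fun c y => by simp }
  exact ⟨T.toContinuousLinearMap, T.toContinuousLinearMap.hasFDerivAt, fun _ => rfl⟩

theorem hasFDerivAt_conjTranspose_mul_self {m n : Type*} [Fintype m] [Fintype n] [DecidableEq m]
    [DecidableEq n] (x : Matrix m n ℂ) :
    ∃ D : Matrix m n ℂ →L[ℝ] Matrix n n ℂ, HasFDerivAt (fun y : Matrix m n ℂ => yᴴ * y) D x ∧
      ∀ e, D e = xᴴ * e + eᴴ * x := by
  obtain ⟨D, hD, eD⟩ := hasFDerivAt_conjTranspose x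
  obtain ⟨D', hD', eD'⟩ := hD.exists_matrix_mul (hasFDerivAt_id (𝕜 := ℝ) x)
  exact ⟨D', hD', fun e => by rw [eD', eD]; rfl⟩

end Calculus

/-! ### Hermite interpolation and spectra of block matrices. -/

section Interpolation

/-- Simultaneous Hermite interpolation at finitely many points. -/
theorem exists_polynomial_jets (f : ℂ → ℂ) (s : Finset ℂ) (N : ℕ) :
    ∃ p : ℂ[X], ∀ z ∈ s, ∀ j < N, (derivative^[j] p).eval z = iteratedDeriv j f z := by
  classical
  choose q hq using fun z : ℂ => exists_jet z N (fun j => iteratedDeriv j f z)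
  obtain ⟨p, hp⟩ := Ideal.exists_forall_sub_mem_ideal
    (I := fun z : s => Ideal.span {(X - C z.1) ^ N})
    (by
      intro i j hij
      rw [Function.onFun, Ideal.isCoprime_span_singleton_iff]
      exact (isCoprime_X_sub_C_of_isUnit_sub
        (sub_ne_zero.mpr (Subtype.coe_injective.ne hij)).isUnit).pow)
    (fun z => q z.1)
  refine ⟨p, fun z hz j hj => ?_⟩
  have := hp ⟨z, hz⟩
  rw [Ideal.mem_span_singleton] at this
  rw [eval_iterate_derivative_eq_of_dvd this hj, hq z j hj]

variable {ι : Type*} [Fintype ι] [DecidableEq ι]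

theorem rootMultiplicity_minpoly_le_card (M : Matrix ι ι ℂ) (z : ℂ) :
    (minpoly ℂ M).rootMultiplicity z ≤ Fintype.card ι := by
  have h := rootMultiplicity_le_rootMultiplicity_of_dvd M.charpoly_monic.ne_zero
    (minpoly_dvd_charpoly M) z
  rw [← count_roots, ← count_roots] at h
  rw [← count_roots]
  refine h.trans ((Multiset.count_le_card _ _).trans ((card_roots' _).trans ?_))
  rw [charpoly_natDegree_eq_dim]

theorem mem_spectrum_iff_minpoly_isRoot {M : Matrix ι ι ℂ} {z : ℂ} :
    z ∈ spectrum ℂ M ↔ (minpoly ℂ M).IsRoot z := by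
  rw [← Matrix.spectrum_toLin', ← Module.End.hasEigenvalue_iff_mem_spectrum,
    Module.End.hasEigenvalue_iff_isRoot, Matrix.minpoly_toLin']

/-- Jordan blocks are no larger than the matrix, so a uniform order `N` lets one polynomial serve
several matrices with the same spectrum. -/
theorem InterpolatesOnSpectrum.of_jets {f : ℂ → ℂ} {M : Matrix ι ι ℂ} {p : ℂ[X]} {N : ℕ}
    (hN : Fintype.card ι ≤ N)
    (hp : ∀ z ∈ spectrum ℂ M, ∀ j < N, (derivative^[j] p).eval z = iteratedDeriv j f z) :
    InterpolatesOnSpectrum f M p := by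
  intro z j hj
  refine hp z ?_ j (hj.trans_le ((rootMultiplicity_minpoly_le_card M z).trans hN))
  rw [mem_spectrum_iff_minpoly_isRoot, ← rootMultiplicity_pos (minpoly.ne_zero M.isIntegral)]
  omega

theorem InterpolatesOnSpectrum.eval_eq {f : ℂ → ℂ} {M : Matrix ι ι ℂ} {p : ℂ[X]}
    (hp : InterpolatesOnSpectrum f M p) {z : ℂ} (hz : z ∈ spectrum ℂ M) : p.eval z = f z := by
  simpa using hp z 0 ((rootMultiplicity_pos (minpoly.ne_zero M.isIntegral)).mpr
    (mem_spectrum_iff_minpoly_isRoot.mp hz))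

theorem spectrum_fromBlocks_self (B K : Matrix ι ι ℂ) :
    spectrum ℂ (fromBlocks B K 0 B) = spectrum ℂ B := by
  ext z
  rw [spectrum.mem_iff, spectrum.mem_iff, Matrix.isUnit_iff_isUnit_det,
    Matrix.isUnit_iff_isUnit_det]
  have : algebraMap ℂ (Matrix (ι ⊕ ι) (ι ⊕ ι) ℂ) z - fromBlocks B K 0 B
      = fromBlocks (algebraMap ℂ _ z - B) (-K) 0 (algebraMap ℂ _ z - B) := by
    simp only [Algebra.algebraMap_eq_smul_one, ← fromBlocks_one, fromBlocks_smul, sub_eq_add_neg,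
      fromBlocks_neg, fromBlocks_add, smul_zero, neg_zero, zero_add]
  rw [this, det_fromBlocks_zero₂₁]
  simp

end Interpolation

/-! ### Perturbation of Hermitian matrices and differentiability of the step. -/

section Hermitian

open scoped Matrix.Norms.L2Operator

variable {ι : Type*} [Fintype ι] [DecidableEq ι]

theorem Matrix.IsHermitian.aeval_eq {B : Matrix ι ι ℂ} (hB : B.IsHermitian) (p : ℂ[X]) :
    aeval B p = Unitary.conjStarAlgAut ℂ _ hB.eigenvectorUnitary
      (diagonal fun i => p.eval (hB.eigenvalues i : ℂ)) := by
  conv_lhs => rw [hB.spectral_theorem]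
  rw [aeval_algHom_apply]
  congr 1
  have : diagonal (RCLike.ofReal ∘ hB.eigenvalues)
      = Matrix.diagonalAlgHom ℂ (fun i => (hB.eigenvalues i : ℂ)) := rfl
  rw [this, aeval_algHom_apply]
  simp [Polynomial.aeval_pi_apply, coe_aeval_eq_eval]

theorem Matrix.IsHermitian.eigenvalues_mem_spectrum_complex {B : Matrix ι ι ℂ}
    (hB : B.IsHermitian) (i : ι) : (hB.eigenvalues i : ℂ) ∈ spectrum ℂ B := by
  rw [hB.spectrum_eq_image_range]
  exact ⟨_, ⟨i, rfl⟩, rfl⟩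

theorem norm_conjStarAlgAut_diagonal (V : unitaryGroup ι ℂ) (d : ι → ℂ) :
    ‖Unitary.conjStarAlgAut ℂ (Matrix ι ι ℂ) V (diagonal d)‖ = ‖d‖ := by
  rw [Unitary.conjStarAlgAut_apply, ← Unitary.coe_star, CStarRing.norm_mul_coe_unitary,
    CStarRing.norm_coe_unitary_mul, l2_opNorm_diagonal]

/-- Bauer–Fike bound: the eigenvalues of a perturbation of a Hermitian matrix are close to
eigenvalues of the matrix. -/
theorem Matrix.IsHermitian.exists_spectrum_norm_sub_le {B₀ B : Matrix ι ι ℂ}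
    (h₀ : B₀.IsHermitian) {μ : ℂ} (hμ : μ ∈ spectrum ℂ B) :
    ∃ z ∈ spectrum ℂ B₀, ‖μ - z‖ ≤ ‖B - B₀‖ := by
  by_contra! hlt
  have hlt' : ∀ i, ‖B - B₀‖ < ‖μ - (h₀.eigenvalues i : ℂ)‖ :=
    fun i => hlt _ (h₀.eigenvalues_mem_spectrum_complex i)
  have hne : ∀ i, μ - (h₀.eigenvalues i : ℂ) ≠ 0 :=
    fun i => norm_pos_iff.mp ((norm_nonneg _).trans_lt (hlt' i))
  set φ := Unitary.conjStarAlgAut ℂ (Matrix ι ι ℂ) h₀.eigenvectorUnitary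
  -- `R` is the resolvent of `B₀` at `μ`; its norm is the reciprocal of the distance from `μ` to the
  -- spectrum, so a Neumann series inverts `μ - B`.
  set R := φ (diagonal fun i => (μ - (h₀.eigenvalues i : ℂ))⁻¹) with hR
  have hD : algebraMap ℂ _ μ - B₀ = φ (diagonal fun i => μ - (h₀.eigenvalues i : ℂ)) := by
    have := h₀.aeval_eq (C μ - X)
    simpa only [map_sub, aeval_C, aeval_X, eval_sub, eval_C, eval_X] using this
  have hDR : (algebraMap ℂ _ μ - B₀) * R = 1 := by
    rw [hD, hR, ← map_mul, diagonal_mul_diagonal]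
    simp [hne]
  have hsmall : ‖R * (B - B₀)‖ < 1 := by
    refine (norm_mul_le _ _).trans_lt ?_
    rcases (norm_nonneg (B - B₀)).eq_or_lt with h0 | h0
    · rw [← h0]; simp
    · rw [← lt_div_iff₀ h0, hR, norm_conjStarAlgAut_diagonal, pi_norm_lt_iff (by positivity)]
      intro i
      rw [norm_inv, one_div]
      exact inv_strictAnti₀ h0 (hlt' i)
  have hfac : algebraMap ℂ _ μ - B = (algebraMap ℂ _ μ - B₀) * (1 - R * (B - B₀)) := by
    rw [mul_sub, ← mul_assoc, hDR]
    simp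
  refine hμ (spectrum.mem_resolventSet_iff.mpr ?_)
  rw [hfac]
  exact (IsUnit.of_mul_eq_one _ hDR).mul (isUnit_one_sub_of_norm_lt_one hsmall)

/-- Unitary diagonalization reduces the norm to a maximum over eigenvalues, so no derivatives of `f`
enter. -/
theorem Matrix.IsHermitian.norm_primaryMatrixFunction_sub_aeval_le {B : Matrix ι ι ℂ}
    (hB : B.IsHermitian) (f : ℂ → ℂ) (p : ℂ[X]) {c : ℝ} (hc : 0 ≤ c)
    (h : ∀ z ∈ spectrum ℂ B, ‖f z - p.eval z‖ ≤ c) :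
    ‖primaryMatrixFunction f B - aeval B p‖ ≤ c := by
  obtain ⟨q, hq⟩ := exists_interpolatesOnSpectrum f B
  rw [primaryMatrixFunction_eq_aeval hq, ← map_sub, hB.aeval_eq, norm_conjStarAlgAut_diagonal,
    pi_norm_le_iff_of_nonneg hc]
  intro i
  have hi := hB.eigenvalues_mem_spectrum_complex i
  rw [eval_sub, hq.eval_eq hi]
  exact h _ hi

/-- On Hermitian matrices near `B₀`, a primary matrix function agrees to first order with any
polynomial that interpolates the scalar function and its derivative on the spectrum of `B₀`. -/
theorem Matrix.IsHermitian.primaryMatrixFunction_sub_aeval_isLittleO {B₀ : Matrix ι ι ℂ}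
    (h₀ : B₀.IsHermitian) {f : ℂ → ℂ} (hf : ∀ z ∈ spectrum ℂ B₀, DifferentiableAt ℂ f z)
    {p : ℂ[X]} (hp : ∀ z ∈ spectrum ℂ B₀, p.eval z = f z)
    (hp' : ∀ z ∈ spectrum ℂ B₀, p.derivative.eval z = deriv f z) :
    (fun B => primaryMatrixFunction f B - aeval B p) =o[𝓝 B₀ ⊓ 𝓟 {B | B.IsHermitian}]
      fun B => B - B₀ := by
  rw [Asymptotics.isLittleO_iff]
  intro c hc
  have hloc : ∀ z ∈ spectrum ℂ B₀, ∀ᶠ w in 𝓝 z, ‖f w - p.eval w‖ ≤ c * ‖w - z‖ := by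
    intro z hz
    have hd := ((hf z hz).hasDerivAt.sub (p.hasDerivAt z)).isLittleO
    filter_upwards [hd.def hc] with w hw
    simpa [hp z hz, hp' z hz] using hw
  have hfin : (spectrum ℂ B₀).Finite := Matrix.finite_spectrum B₀
  -- The spectrum is finite, so one radius works at all eigenvalues; Bauer–Fike then puts each
  -- eigenvalue of `B` in one of these discs.
  have hunif : ∀ᶠ δ : ℝ in 𝓝[>] 0, ∀ z ∈ spectrum ℂ B₀, ∀ w, ‖w - z‖ < δ →
      ‖f w - p.eval w‖ ≤ c * ‖w - z‖ := by
    rw [eventually_all_finite hfin]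
    intro z hz
    obtain ⟨δ, hδ, h⟩ := Metric.eventually_nhds_iff.mp (hloc z hz)
    filter_upwards [Ioo_mem_nhdsGT hδ] with δ' hδ' w hw
    exact h (by rw [dist_eq_norm]; exact hw.trans hδ'.2)
  obtain ⟨δ, hδ, hδ0⟩ := (hunif.and self_mem_nhdsWithin).exists
  rw [eventually_inf_principal]
  filter_upwards [Metric.ball_mem_nhds B₀ hδ0] with B hB hBh
  rw [Metric.mem_ball, dist_eq_norm] at hB
  refine IsHermitian.norm_primaryMatrixFunction_sub_aeval_le hBh f p (by positivity) ?_
  intro w hw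
  obtain ⟨z, hz, hwz⟩ := h₀.exists_spectrum_norm_sub_le hw
  exact (hδ z hz w (hwz.trans_lt hB)).trans (by gcongr)

/-- The step `X ↦ X f(X* X)` is Fréchet differentiable where `f` is differentiable on the spectrum,
with the derivative of the interpolating polynomial step. -/
theorem hasFDerivAt_polarStep {m n : ℕ} {f : ℂ → ℂ} {X₀ : Matrix (Fin m) (Fin n) ℂ}
    (hf : ∀ z ∈ spectrum ℂ (X₀ᴴ * X₀), DifferentiableAt ℂ f z) {p : ℂ[X]}
    (hp : ∀ z ∈ spectrum ℂ (X₀ᴴ * X₀), p.eval z = f z)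
    (hp' : ∀ z ∈ spectrum ℂ (X₀ᴴ * X₀), p.derivative.eval z = deriv f z) :
    ∃ D : Matrix (Fin m) (Fin n) ℂ →L[ℝ] Matrix (Fin m) (Fin n) ℂ,
      HasFDerivAt (polarStep f) D X₀ ∧ ∀ E, D E = E * aeval (X₀ᴴ * X₀) p +
        X₀ * (aeval (fromBlocks (X₀ᴴ * X₀) (X₀ᴴ * E + Eᴴ * X₀) 0 (X₀ᴴ * X₀)) p).toBlocks₁₂ := by
  obtain ⟨D₁, h₁, e₁⟩ := hasFDerivAt_conjTranspose_mul_self X₀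
  obtain ⟨D₂, h₂, e₂⟩ := h₁.exists_aeval p
  -- `Y* Y` is always Hermitian, so the estimate restricted to Hermitian matrices suffices.
  have hlim : Tendsto (fun Y : Matrix (Fin m) (Fin n) ℂ => Yᴴ * Y) (𝓝 X₀)
      (𝓝 (X₀ᴴ * X₀) ⊓ 𝓟 {B | B.IsHermitian}) :=
    tendsto_inf.mpr ⟨h₁.continuousAt, tendsto_principal.mpr
      (Eventually.of_forall fun Y => isHermitian_conjTranspose_mul_self Y)⟩
  have ho := ((isHermitian_conjTranspose_mul_self X₀).primaryMatrixFunction_sub_aeval_isLittleO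
    hf hp hp').comp_tendsto hlim
  have h₀ : primaryMatrixFunction f (X₀ᴴ * X₀) = aeval (X₀ᴴ * X₀) p := by
    rw [← sub_eq_zero, ← norm_le_zero_iff]
    exact (isHermitian_conjTranspose_mul_self X₀).norm_primaryMatrixFunction_sub_aeval_le f p
      le_rfl fun z hz => by simp [hp z hz]
  have h₃ : HasFDerivAt (fun Y : Matrix (Fin m) (Fin n) ℂ => primaryMatrixFunction f (Yᴴ * Y)
      - aeval (Yᴴ * Y) p) (0 : Matrix (Fin m) (Fin n) ℂ →L[ℝ] Matrix (Fin n) (Fin n) ℂ) X₀ := by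
    rw [hasFDerivAt_iff_isLittleO]
    simp only [h₀, sub_self, sub_zero, _root_.zero_apply]
    exact ho.trans_isBigO h₁.isBigO_sub
  have h₄ : HasFDerivAt (fun Y : Matrix (Fin m) (Fin n) ℂ => primaryMatrixFunction f (Yᴴ * Y))
      D₂ X₀ := by
    have h := (h₃.add h₂).congr_of_eventuallyEq (.of_forall fun Y => by
      exact (sub_add_cancel (primaryMatrixFunction f (Yᴴ * Y)) (aeval (Yᴴ * Y) p)).symm)
    rwa [zero_add] at h
  obtain ⟨D, hD, eD⟩ := (hasFDerivAt_id (𝕜 := ℝ) X₀).exists_matrix_mul h₄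
  refine ⟨D, hD, fun E => ?_⟩
  rw [eD, ← e₁, e₂, h₀, toBlocks_fromBlocks₁₂, add_comm]
  rfl

end Hermitian

/-! ### The polar factor as an inverse square root step. -/

section PolarFactor

/-- Positivity of the eigenvalues `x` makes the principal value of `(x²)^(-1/2)` equal to `x⁻¹`. -/
theorem Matrix.PosDef.mul_primaryMatrixFunction_sq {ι : Type*} [Fintype ι] [DecidableEq ι]
    {H : Matrix ι ι ℂ} (hH : H.PosDef) :
    H * primaryMatrixFunction (fun w : ℂ => w ^ (-(1 / 2) : ℂ)) (H ^ 2) = 1 := by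
  obtain ⟨p, hp⟩ := exists_interpolatesOnSpectrum (fun w : ℂ => w ^ (-(1 / 2) : ℂ)) (H ^ 2)
  have hsq : ∀ i, p.eval ((hH.1.eigenvalues i : ℂ) ^ 2) = (hH.1.eigenvalues i : ℂ)⁻¹ := by
    intro i
    have hpos := hH.eigenvalues_pos i
    rw [hp.eval_eq (spectrum.pow_mem_pow _ 2 (hH.1.eigenvalues_mem_spectrum_complex i)),
      ← Complex.ofReal_pow, Complex.cpow_neg, ← Complex.ofReal_one, ← Complex.ofReal_ofNat,
      ← Complex.ofReal_div, ← Complex.ofReal_cpow (by positivity), ← Real.sqrt_eq_rpow,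
      Real.sqrt_sq hpos.le]
  have h1 := hH.1.aeval_eq (X * p.comp (X ^ 2) : ℂ[X])
  simp only [map_mul, aeval_X, aeval_comp, map_pow] at h1
  rw [primaryMatrixFunction_eq_aeval hp, h1]
  simp only [eval_mul, eval_X, eval_comp, eval_pow, hsq]
  have : (fun i => (hH.1.eigenvalues i : ℂ) * (hH.1.eigenvalues i : ℂ)⁻¹) = fun _ => 1 := by
    funext i
    exact mul_inv_cancel₀ (Complex.ofReal_ne_zero.mpr (hH.eigenvalues_pos i).ne')
  rw [this, diagonal_one, map_one]

theorem Matrix.PosDef.mem_slitPlane_of_mem_spectrum_sq {ι : Type*} [Fintype ι] [DecidableEq ι]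
    {H : Matrix ι ι ℂ} (hH : H.PosDef) {z : ℂ} (hz : z ∈ spectrum ℂ (H ^ 2)) :
    z ∈ Complex.slitPlane := by
  have h2 : (H ^ 2).PosDef := by
    have := (posSemidef_conjTranspose_mul_self H).posDef_iff_isUnit.mpr
      (hH.isUnit.star.mul hH.isUnit)
    rwa [hH.1.eq, ← sq] at this
  rw [h2.1.spectrum_eq_image_range] at hz
  obtain ⟨_, ⟨i, rfl⟩, rfl⟩ := hz
  exact Or.inl (by simpa using h2.eigenvalues_pos i)

theorem IsPolarDecomposition.conjTranspose_mul_self {m n : ℕ} {A U : Matrix (Fin m) (Fin n) ℂ}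
    {H : Matrix (Fin n) (Fin n) ℂ} (h : IsPolarDecomposition A U H) : Aᴴ * A = H ^ 2 := by
  obtain ⟨hU, hH, rfl⟩ := h
  rw [conjTranspose_mul, hH.1.eq, Matrix.mul_assoc, ← Matrix.mul_assoc Uᴴ, hU, Matrix.one_mul, sq]

theorem IsPolarDecomposition.polarStep_eq {m n : ℕ} {A U : Matrix (Fin m) (Fin n) ℂ}
    {H : Matrix (Fin n) (Fin n) ℂ} (h : IsPolarDecomposition A U H) :
    polarStep (fun w : ℂ => w ^ (-(1 / 2) : ℂ)) A = U := by
  rw [polarStep, h.conjTranspose_mul_self, h.2.2, Matrix.mul_assoc,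
    h.2.1.mul_primaryMatrixFunction_sq, Matrix.mul_one]

/-- Uniqueness: any admissible `U` is given by a formula in `A` alone. -/
theorem IsPolarDecomposition.polarFactor_eq {m n : ℕ} {A U : Matrix (Fin m) (Fin n) ℂ}
    {H : Matrix (Fin n) (Fin n) ℂ} (h : IsPolarDecomposition A U H) : polarFactor A = U := by
  have hex : ∃ U : Matrix (Fin m) (Fin n) ℂ, ∃ H : Matrix (Fin n) (Fin n) ℂ,
      IsPolarDecomposition A U H := ⟨U, H, h⟩
  rw [polarFactor, dif_pos hex]
  obtain ⟨H', h'⟩ := hex.choose_spec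
  rw [← h'.polarStep_eq, h.polarStep_eq]

open scoped MatrixOrder Matrix.Norms.L2Operator in
theorem exists_isPolarDecomposition {m n : ℕ} {A : Matrix (Fin m) (Fin n) ℂ}
    (h : IsUnit (Aᴴ * A)) : ∃ U H, IsPolarDecomposition A U H := by
  have hps := posSemidef_conjTranspose_mul_self A
  set H := CFC.sqrt (Aᴴ * A)
  have hHH : H * H = Aᴴ * A := CFC.sqrt_mul_sqrt_self _ (nonneg_iff_posSemidef.mpr hps)
  have hHp : H.PosSemidef := nonneg_iff_posSemidef.mp (CFC.sqrt_nonneg _)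
  have hHu : IsUnit H := by
    rw [← hHH, Matrix.isUnit_iff_isUnit_det, det_mul] at h
    exact (Matrix.isUnit_iff_isUnit_det _).mpr (isUnit_of_mul_isUnit_left h)
  have hdet := (Matrix.isUnit_iff_isUnit_det _).mp hHu
  refine ⟨A * H⁻¹, H, ?_, hHp.posDef_iff_isUnit.mpr hHu, ?_⟩
  · rw [conjTranspose_mul, conjTranspose_nonsing_inv, hHp.1.eq, Matrix.mul_assoc,
      ← Matrix.mul_assoc Aᴴ, ← hHH, Matrix.mul_assoc H, mul_nonsing_inv _ hdet, Matrix.mul_one,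
      nonsing_inv_mul _ hdet]
  · rw [Matrix.mul_assoc, nonsing_inv_mul _ hdet, Matrix.mul_one]

/-- Near a full-rank matrix, the polar factor is the inverse square root step. -/
theorem IsPolarDecomposition.polarFactor_eventuallyEq {m n : ℕ} {A U : Matrix (Fin m) (Fin n) ℂ}
    {H : Matrix (Fin n) (Fin n) ℂ} (h : IsPolarDecomposition A U H) :
    polarFactor (m := m) (n := n) =ᶠ[𝓝 A] polarStep (fun w : ℂ => w ^ (-(1 / 2) : ℂ)) := by
  have hcont : Continuous fun Y : Matrix (Fin m) (Fin n) ℂ => (Yᴴ * Y).det := by fun_prop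
  have hA : (Aᴴ * A).det ≠ 0 := by
    rw [h.conjTranspose_mul_self, det_pow]
    exact pow_ne_zero _ ((Matrix.isUnit_iff_isUnit_det _).mp h.2.1.isUnit).ne_zero
  filter_upwards [hcont.continuousAt.eventually_ne hA] with Y hY
  obtain ⟨U', H', h'⟩ :=
    exists_isPolarDecomposition ((Matrix.isUnit_iff_isUnit_det _).mpr hY.isUnit)
  rw [h'.polarFactor_eq, h'.polarStep_eq]

end PolarFactor

/-! ### One step of the coupled iterations. -/

section Iteration

variable {m n : ℕ}

theorem fromBlocks_skew_sq (H K : Matrix (Fin n) (Fin n) ℂ) :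
    (fromBlocks H K 0 (-H)) ^ 2 = fromBlocks (H ^ 2) (H * K - K * H) 0 (H ^ 2) := by
  rw [sq, fromBlocks_multiply]
  simp [sq, sub_eq_add_neg]

theorem fromBlocks_sym_sq (H K : Matrix (Fin n) (Fin n) ℂ) :
    (fromBlocks H K 0 H) ^ 2 = fromBlocks (H ^ 2) (H * K + K * H) 0 (H ^ 2) := by
  rw [sq, fromBlocks_multiply]
  simp [sq]

/-- One step of the sign iteration on both block matrices, and of the polar iteration together with
its derivative, expressed through common blocks. -/
theorem exists_blocks_step {U F : Matrix (Fin m) (Fin n) ℂ} {H Ω S : Matrix (Fin n) (Fin n) ℂ}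
    (hU : Uᴴ * U = 1) (hH : Hᴴ = H) (hΩ : Ωᴴ = -Ω) (hS : Sᴴ = S) (hF : Uᴴ * F = Ω + S)
    {f : ℂ → ℂ} (hf : ∀ z ∈ spectrum ℂ (H ^ 2), DifferentiableAt ℂ f z) :
    DifferentiableAt ℝ (polarStep (m := m) (n := n) f) (U * H) ∧
    ∃ P L₁ L₂ : Matrix (Fin n) (Fin n) ℂ,
      primaryMatrixFunction f (fromBlocks (H ^ 2) (H * Ω - Ω * H) 0 (H ^ 2))
        = fromBlocks P L₁ 0 P ∧
      primaryMatrixFunction f (fromBlocks (H ^ 2) (H * S + S * H) 0 (H ^ 2))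
        = fromBlocks P L₂ 0 P ∧
      H * P = P * H ∧ H * L₁ + Ω * P = P * Ω - L₁ * H ∧ H * L₂ + S * P = P * S + L₂ * H ∧
      polarStep f (U * H) = U * (H * P) ∧
      frechetDeriv (polarStep f) (U * H) F = F * P + U * (H * (L₁ + L₂)) := by
  have hB : (U * H)ᴴ * (U * H) = H ^ 2 := by
    rw [conjTranspose_mul, hH, Matrix.mul_assoc, ← Matrix.mul_assoc Uᴴ, hU, Matrix.one_mul, sq]
  have hdir : (U * H)ᴴ * F + Fᴴ * (U * H) = (H * Ω - Ω * H) + (H * S + S * H) := by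
    have hF' : Fᴴ * U = -Ω + S := by
      have h := congrArg conjTranspose hF
      rwa [conjTranspose_mul, conjTranspose_conjTranspose, conjTranspose_add, hΩ, hS] at h
    rw [conjTranspose_mul, hH, Matrix.mul_assoc, hF, ← Matrix.mul_assoc, hF']
    noncomm_ring
  -- Order `n + n` covers the block matrices; the extra `2` secures the first-derivative condition
  -- for every `n`.
  obtain ⟨p, hp⟩ := exists_polynomial_jets f (Matrix.finite_spectrum (H ^ 2)).toFinset (n + n + 2)
  simp only [Set.Finite.mem_toFinset] at hp
  have hpB : InterpolatesOnSpectrum f (H ^ 2) p := .of_jets (by simp; omega) hp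
  have hpK : ∀ K, InterpolatesOnSpectrum f (fromBlocks (H ^ 2) K 0 (H ^ 2)) p := fun K =>
    .of_jets (N := n + n + 2) (by simp) (by rwa [spectrum_fromBlocks_self])
  obtain ⟨L, hL⟩ := exists_linearMap_aeval_fromBlocks (H ^ 2) p
  obtain ⟨D, hD, eD⟩ := hasFDerivAt_polarStep (X₀ := U * H) (f := f) (p := p)
    (by rwa [hB]) (by rw [hB]; exact fun z hz => hpB.eval_eq hz)
    (by rw [hB]; exact fun z hz => by simpa using hp z hz 1 (by omega))
  -- The blocks of this identity for the two block matrices are the three commutation relations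
  -- claimed.
  have hcomm : ∀ M : Matrix (Fin n ⊕ Fin n) (Fin n ⊕ Fin n) ℂ,
      M * aeval (M ^ 2) p = aeval (M ^ 2) p * M := fun M => by
    have h := Commute.all (X : ℂ[X]) (p.comp (X ^ 2))
    have h' := congrArg (aeval M) h.eq
    simpa [aeval_comp] using h'
  have h₁ := hcomm (fromBlocks H Ω 0 (-H))
  have h₂ := hcomm (fromBlocks H S 0 H)
  rw [fromBlocks_skew_sq, hL, fromBlocks_multiply, fromBlocks_multiply, fromBlocks_inj] at h₁
  rw [fromBlocks_sym_sq, hL, fromBlocks_multiply, fromBlocks_multiply, fromBlocks_inj] at h₂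
  refine ⟨hD.differentiableAt, aeval (H ^ 2) p, L (H * Ω - Ω * H), L (H * S + S * H), ?_, ?_, ?_,
    ?_, ?_, ?_, ?_⟩
  · rw [primaryMatrixFunction_eq_aeval (hpK _), hL]
  · rw [primaryMatrixFunction_eq_aeval (hpK _), hL]
  · simpa using h₁.1
  · simpa [sub_eq_add_neg] using h₁.2.1
  · simpa using h₂.2.1
  · rw [polarStep, hB, primaryMatrixFunction_eq_aeval hpB, Matrix.mul_assoc]
  · rw [frechetDeriv, hD.fderiv, eD, hB, hdir, hL, toBlocks_fromBlocks₁₂, map_add,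
      Matrix.mul_assoc]

/-- If a primary matrix function commutes with the conjugate transpose, then the blocks of its value
at a block triangular matrix with Hermitian blocks are Hermitian. -/
theorem isHermitian_blocks_of_star {f : ℂ → ℂ} {D : Set ℂ}
    (hstar : ∀ (p : ℕ) (Z : Matrix (Fin p) (Fin p) ℂ),
      spectrum ℂ Z ⊆ D → spectrum ℂ Zᴴ ⊆ D →
        primaryMatrixFunction f Zᴴ = (primaryMatrixFunction f Z)ᴴ)
    {B K P L : Matrix (Fin n) (Fin n) ℂ} (hB : Bᴴ = B) (hK : Kᴴ = K)
    (hD : spectrum ℂ B ⊆ D)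
    (h : primaryMatrixFunction f (fromBlocks B K 0 B) = fromBlocks P L 0 P) :
    Pᴴ = P ∧ Lᴴ = L := by
  set M := fromBlocks B K 0 B with hM
  let e₁ := reindexAlgEquiv ℂ ℂ (finSumFinEquiv (m := n) (n := n))
  let e₂ := reindexAlgEquiv ℂ ℂ ((Equiv.sumComm (Fin n) (Fin n)).trans finSumFinEquiv)
  have hspec : spectrum ℂ M ⊆ D := by rwa [hM, spectrum_fromBlocks_self]
  have hs : (e₁ M)ᴴ = e₂ M := by
    -- For Hermitian blocks the adjoint is the block swap, a reindexing, and primary functions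
    -- commute with reindexing because it preserves the minimal polynomial.
    have hsw : Mᴴ = M.submatrix (Equiv.sumComm _ _) (Equiv.sumComm _ _) := by
      rw [hM, fromBlocks_conjTranspose, hB, hK, conjTranspose_zero]
      exact (fromBlocks_submatrix_sum_swap_sum_swap _ _ _ _).symm
    have : (e₁ M)ᴴ = e₁ (Mᴴ) := rfl
    rw [this, hsw]
    rfl
  have hpe : ∀ e : Matrix (Fin n ⊕ Fin n) (Fin n ⊕ Fin n) ℂ ≃ₐ[ℂ]
      Matrix (Fin (n + n)) (Fin (n + n)) ℂ,
      primaryMatrixFunction f (e M) = e (primaryMatrixFunction f M) := fun e => by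
    obtain ⟨p, hp⟩ := exists_interpolatesOnSpectrum f M
    have hp' : InterpolatesOnSpectrum f (e M) p := by
      rw [InterpolatesOnSpectrum, minpoly.algEquiv_eq e M]
      exact hp
    rw [primaryMatrixFunction_eq_aeval hp, primaryMatrixFunction_eq_aeval hp', aeval_algHom_apply]
  have key := hstar _ (e₁ M) (by rwa [AlgEquiv.spectrum_eq]) (by rwa [hs, AlgEquiv.spectrum_eq])
  rw [hs, hpe, hpe, h] at key
  have hsw : (fromBlocks P L 0 P).submatrix (Equiv.sumComm _ _) (Equiv.sumComm _ _)
      = (fromBlocks P L 0 P)ᴴ := by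
    apply e₁.injective
    exact key
  have hsw' := (fromBlocks_submatrix_sum_swap_sum_swap P L 0 P).symm.trans hsw
  rw [fromBlocks_conjTranspose, fromBlocks_inj] at hsw'
  exact ⟨hsw'.1.symm, hsw'.2.2.1.symm⟩

end Iteration

/-! ### The invariant and the passage to the limit. -/

theorem theorem2p1 {m n : ℕ} (hmn : n ≤ m)
    (A U : Matrix (Fin m) (Fin n) ℂ) (H : Matrix (Fin n) (Fin n) ℂ)
    (hA : A.rank = n) (hpolar : IsPolarDecomposition A U H)
    (E : Matrix (Fin m) (Fin n) ℂ)
    -- the scalar function `f` defining the primary matrix function `h`, holomorphic on `D`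
    (f : ℂ → ℂ) (D : Set ℂ) (hD : IsOpen D) (hf : ContDiffOn ℂ ∞ f D)
    -- `h(Z*) = h(Z)*` whenever both spectra lie in `D`
    (hstar : ∀ (p : ℕ) (Z : Matrix (Fin p) (Fin p) ℂ),
      spectrum ℂ Z ⊆ D → spectrum ℂ Zᴴ ⊆ D →
        primaryMatrixFunction f Zᴴ = (primaryMatrixFunction f Z)ᴴ)
    -- the sign iteration `Z_{k+1} = Z_k h(Z_k²)` from the first initial condition
    (Z : ℕ → Matrix (Fin n ⊕ Fin n) (Fin n ⊕ Fin n) ℂ)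
    (hZ0 : Z 0 = Matrix.fromBlocks H (skewPart (Uᴴ * E)) 0 (-H))
    (hZ : ∀ k, Z (k + 1) = Z k * primaryMatrixFunction f (Z k ^ 2))
    (hZD : ∀ k, spectrum ℂ (Z k ^ 2) ⊆ D)
    (hZlim : Tendsto Z atTop (𝓝 (matrixSign (Z 0))))
    -- the sign iteration from the second initial condition
    (W : ℕ → Matrix (Fin n ⊕ Fin n) (Fin n ⊕ Fin n) ℂ)
    (hW0 : W 0 = Matrix.fromBlocks H (symPart (Uᴴ * E)) 0 H)
    (hW : ∀ k, W (k + 1) = W k * primaryMatrixFunction f (W k ^ 2))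
    (hWD : ∀ k, spectrum ℂ (W k ^ 2) ⊆ D)
    (hWlim : Tendsto W atTop (𝓝 (matrixSign (W 0))))
    -- the coupled iteration `X_{k+1} = g(X_k)`, `E_{k+1} = L_g(X_k, E_k)`
    (X F : ℕ → Matrix (Fin m) (Fin n) ℂ)
    (hX0 : X 0 = A) (hX : ∀ k, X (k + 1) = polarStep f (X k))
    (hF0 : F 0 = E) (hF : ∀ k, F (k + 1) = frechetDeriv (polarStep f) (X k) (F k)) :
    -- the iteration is well defined
    (∀ k, spectrum ℂ ((X k)ᴴ * X k) ⊆ D) ∧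
    (∀ k, DifferentiableAt ℝ (polarStep (m := m) (n := n) f) (X k)) ∧
    -- and converges to `𝒫(A) = U` and `L_𝒫(A, E)`
    polarFactor A = U ∧
    DifferentiableAt ℝ (polarFactor (m := m) (n := n)) A ∧
    Tendsto X atTop (𝓝 U) ∧
    Tendsto F atTop (𝓝 (frechetDeriv polarFactor A E)) := by

  obtain ⟨hU, hH, rfl⟩ := id hpolar
  have hdiff : ∀ {B : Matrix (Fin n) (Fin n) ℂ}, spectrum ℂ B ⊆ D →
      ∀ z ∈ spectrum ℂ B, DifferentiableAt ℂ f z := fun h z hz =>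
    (hf.differentiableOn (by simp)).differentiableAt (hD.mem_nhds (h hz))
  -- The factor `H⁻¹` makes the component of `E` orthogonal to the range of `U` equal to `K H`; it
  -- then evolves as `K H_k` with `K` fixed.
  set K := (E - U * (Uᴴ * E)) * H⁻¹ with hK
  have hUK : Uᴴ * K = 0 := by
    rw [hK, ← Matrix.mul_assoc, Matrix.mul_sub, ← Matrix.mul_assoc Uᴴ U, hU, Matrix.one_mul,
      sub_self, Matrix.zero_mul]
  have hUF : ∀ B H' : Matrix (Fin n) (Fin n) ℂ, Uᴴ * (U * B + K * H') = B := fun B H' => by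
    rw [Matrix.mul_add, ← Matrix.mul_assoc, hU, ← Matrix.mul_assoc, hUK, Matrix.one_mul,
      Matrix.zero_mul, add_zero]
  have hskew : (skewPart (Uᴴ * E))ᴴ = -skewPart (Uᴴ * E) := by
    simp [skewPart, ← smul_neg]
  have hsym : (symPart (Uᴴ * E))ᴴ = symPart (Uᴴ * E) := by
    simp [symPart, add_comm]
  have hsum : skewPart (Uᴴ * E) + symPart (Uᴴ * E) = Uᴴ * E := by
    rw [skewPart, symPart, ← smul_add, sub_add_add_cancel, ← two_smul ℂ, smul_smul]
    norm_num
  have hE : E = U * (skewPart (Uᴴ * E) + symPart (Uᴴ * E)) + K * H := by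
    rw [hsum, hK, Matrix.mul_assoc,
      nonsing_inv_mul _ ((Matrix.isUnit_iff_isUnit_det _).mp hH.isUnit), Matrix.mul_one,
      add_sub_cancel]
  have inv : ∀ k, ∃ H' Ω S : Matrix (Fin n) (Fin n) ℂ, H'ᴴ = H' ∧ Ωᴴ = -Ω ∧ Sᴴ = S ∧
      Z k = fromBlocks H' Ω 0 (-H') ∧ W k = fromBlocks H' S 0 H' ∧ X k = U * H' ∧
      F k = U * (Ω + S) + K * H' ∧ spectrum ℂ (H' ^ 2) ⊆ D := by
    have hspec : ∀ k, ∀ H' Ω : Matrix (Fin n) (Fin n) ℂ, Z k = fromBlocks H' Ω 0 (-H') →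
        spectrum ℂ (H' ^ 2) ⊆ D := fun k H' Ω h => by
      have := hZD k
      rwa [h, fromBlocks_skew_sq, spectrum_fromBlocks_self] at this
    intro k
    induction k with
    | zero => exact ⟨H, _, _, hH.1.eq, hskew, hsym, hZ0, hW0, hX0, hF0.trans hE, hspec 0 _ _ hZ0⟩
    | succ k ih =>
      obtain ⟨H', Ω, S, hH', hΩ, hS, hZk, hWk, hXk, hFk, hs⟩ := ih
      obtain ⟨-, P, L₁, L₂, hP₁, hP₂, hc, hc₁, hc₂, hX', hF'⟩ := exists_blocks_step (F := F k) hU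
        hH' hΩ hS (by rw [hFk, hUF]) (hdiff hs)
      have hH2 : (H' ^ 2)ᴴ = H' ^ 2 := by rw [conjTranspose_pow, hH']
      obtain ⟨hPs, hL₁⟩ := isHermitian_blocks_of_star hstar hH2
        (by rw [conjTranspose_sub, conjTranspose_mul, conjTranspose_mul, hH', hΩ]; noncomm_ring)
        hs hP₁
      obtain ⟨-, hL₂⟩ := isHermitian_blocks_of_star hstar hH2
        (by rw [conjTranspose_add, conjTranspose_mul, conjTranspose_mul, hH', hS, add_comm])
        hs hP₂
      have hZ' : Z (k + 1) = fromBlocks (H' * P) (H' * L₁ + Ω * P) 0 (-(H' * P)) := by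
        rw [hZ, hZk, fromBlocks_skew_sq, hP₁, fromBlocks_multiply]
        simp
      refine ⟨H' * P, H' * L₁ + Ω * P, H' * L₂ + S * P, ?_, ?_, ?_, hZ', ?_, ?_, ?_,
        hspec _ _ _ hZ'⟩
      · rw [conjTranspose_mul, hPs, hH', hc]
      · rw [conjTranspose_add, conjTranspose_mul, conjTranspose_mul, hL₁, hH', hPs, hΩ, hc₁]
        noncomm_ring
      · rw [conjTranspose_add, conjTranspose_mul, conjTranspose_mul, hL₂, hH', hPs, hS, hc₂,
          add_comm]
      · rw [hW, hWk, fromBlocks_sym_sq, hP₂, fromBlocks_multiply]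
        simp
      · rw [hX, hXk, hX']
      · rw [hF, hXk, hF', hFk]
        simp only [Matrix.add_mul, Matrix.mul_add, Matrix.mul_assoc]
        abel
  have hblocks : ∀ k, X k = U * (Z k).toBlocks₁₁ ∧
      F k = U * ((Z k).toBlocks₁₂ + (W k).toBlocks₁₂) + K * (Z k).toBlocks₁₁ := fun k => by
    obtain ⟨H', Ω, S, -, -, -, hZk, hWk, hXk, hFk, -⟩ := inv k
    rw [hZk, hWk, toBlocks_fromBlocks₁₁, toBlocks_fromBlocks₁₂, toBlocks_fromBlocks₁₂]
    exact ⟨hXk, hFk⟩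
  -- With `w ^ (-1/2)` for `f`, the same blocks express both signs and the derivative of the polar
  -- factor.
  obtain ⟨hd, P, L₁, L₂, hP₁, hP₂, -, -, -, hXl, hFl⟩ := exists_blocks_step (F := E)
    (f := fun w : ℂ => w ^ (-(1 / 2) : ℂ)) hU hH.1.eq hskew hsym hsum.symm
    (fun z hz => differentiableAt_id.cpow_const (hH.mem_slitPlane_of_mem_spectrum_sq hz))
  have hHP : H * P = 1 := by
    rw [hpolar.polarStep_eq] at hXl
    rw [← Matrix.one_mul (H * P), ← hU, Matrix.mul_assoc, ← hXl]
  have hsZ : matrixSign (Z 0)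
      = fromBlocks 1 (H * L₁ + skewPart (Uᴴ * E) * P) 0 (-1) := by
    rw [matrixSign, hZ0, fromBlocks_skew_sq, hP₁, fromBlocks_multiply]
    simp [hHP]
  have hsW : matrixSign (W 0)
      = fromBlocks 1 (H * L₂ + symPart (Uᴴ * E) * P) 0 1 := by
    rw [matrixSign, hW0, fromBlocks_sym_sq, hP₂, fromBlocks_multiply]
    simp [hHP]
  have h11 : Tendsto (fun k => (Z k).toBlocks₁₁) atTop (𝓝 1) := by
    have h := ((by unfold toBlocks₁₁; fun_prop : Continuous (toBlocks₁₁ :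
      Matrix (Fin n ⊕ Fin n) (Fin n ⊕ Fin n) ℂ → _)).tendsto _).comp hZlim
    rwa [hsZ, toBlocks_fromBlocks₁₁] at h
  have hcont : Continuous (toBlocks₁₂ : Matrix (Fin n ⊕ Fin n) (Fin n ⊕ Fin n) ℂ → _) := by
    unfold toBlocks₁₂; fun_prop
  have hZ12 := (hcont.tendsto _).comp hZlim
  have hW12 := (hcont.tendsto _).comp hWlim
  rw [hsZ, toBlocks_fromBlocks₁₂] at hZ12
  rw [hsW, toBlocks_fromBlocks₁₂] at hW12
  refine ⟨fun k => ?_, fun k => ?_, hpolar.polarFactor_eq, ?_, ?_, ?_⟩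
  · obtain ⟨H', Ω, S, hH', -, -, -, -, hXk, -, hs⟩ := inv k
    rwa [hXk, conjTranspose_mul, hH', Matrix.mul_assoc, ← Matrix.mul_assoc Uᴴ, hU, Matrix.one_mul,
      ← sq]
  · obtain ⟨H', Ω, S, hH', hΩ, hS, -, -, hXk, hFk, hs⟩ := inv k
    rw [hXk]
    exact (exists_blocks_step (F := F k) hU hH' hΩ hS (by rw [hFk, hUF]) (hdiff hs)).1
  · exact hd.congr_of_eventuallyEq hpolar.polarFactor_eventuallyEq
  · have h : Tendsto (fun k => U * (Z k).toBlocks₁₁) atTop (𝓝 (U * (1 : Matrix (Fin n) (Fin n) ℂ))) :=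
      ((by fun_prop : Continuous fun M : Matrix (Fin n) (Fin n) ℂ => U * M).tendsto _).comp h11
    rw [Matrix.mul_one] at h
    exact h.congr fun k => (hblocks k).1.symm
  · have hlim : frechetDeriv polarFactor (U * H) E
        = U * ((H * L₁ + skewPart (Uᴴ * E) * P) + (H * L₂ + symPart (Uᴴ * E) * P)) +
          K * (1 : Matrix (Fin n) (Fin n) ℂ) := by
      have : frechetDeriv polarFactor (U * H) E
          = frechetDeriv (polarStep fun w : ℂ => w ^ (-(1 / 2) : ℂ)) (U * H) E := by
        rw [frechetDeriv, frechetDeriv, hpolar.polarFactor_eventuallyEq.fderiv_eq]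
      rw [this, hFl]
      have hEP : E * P = U * (skewPart (Uᴴ * E) * P + symPart (Uᴴ * E) * P) +
          K * (1 : Matrix (Fin n) (Fin n) ℂ) := by
        conv_lhs => rw [hE]
        -- Writing `1` as `H * P` turns the limit `K` of `K H_k` into the part `K H P` of `E P`.
        rw [← hHP, Matrix.add_mul, Matrix.mul_assoc, Matrix.add_mul, Matrix.mul_assoc]
      rw [hEP]
      simp only [Matrix.mul_add]
      abel
    rw [hlim]
    have hcontF : Continuous fun q : Matrix (Fin n) (Fin n) ℂ × Matrix (Fin n) (Fin n) ℂ ×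
        Matrix (Fin n) (Fin n) ℂ => U * (q.1 + q.2.1) + K * q.2.2 := by fun_prop
    exact ((hcontF.tendsto _).comp (hZ12.prodMk_nhds (hW12.prodMk_nhds h11))).congr
      fun k => (hblocks k).2.symm
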